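/- Let $t=(t^{(1)},t^{(2)},t^{(3)})$ with $t^{(i)}=(t^{(i)}_k)_{k\ge1}$, and let $\widetilde\tau_{\bm m}\in\mathbb C[[t]]$, $\bm m=(m_1,m_2)\in\mathbb Z^2$, be a family of nonzero formal power series. Put $\bm e_1=(1,0)$, $\bm e_2=(0,1)$, $\bm e=(1,1)$, $\xi(t^{(i)},z)=\sum_{k\ge1}t^{(i)}_kz^k$, and let $t\pm[w]_i$ be obtained from $t$ by replacing $t^{(i)}_k$ with $t^{(i)}_k\pm w^k/k$ for all $k\geq 1$. Define the wave functions and adjoint wave functions \begin{align*} &\Psi_1(\bm m,t,z)=z^{m_1}e^{\xi(t^{(1)},z)}\frac{\widetilde\tau_{\bm m}(t-[z^{-1}]_1)}{\widetilde\tau_{\bm m}(t)},&& \widetilde\Psi_1(\bm m,t,z)=z^{-m_1+1}e^{-\xi(t^{(1)},z)}\frac{\widetilde\tau_{\bm m}(t+[z^{-1}]_1)}{\widetilde\tau_{\bm m}(t)},\\ &\Psi_2(\bm m,t,z)=z^{m_2}e^{\xi(t^{(2)},z^{-1})}\frac{\widetilde\tau_{\bm m+\bm e}(t-[z]_2)}{\widetilde\tau_{\bm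 m}(t)},&& \widetilde\Psi_2(\bm m,t,z)=z^{-m_2+1}e^{-\xi(t^{(2)},z^{-1})}\frac{\widetilde\tau_{\bm m-\bm e}(t+[z]_2)}{\widetilde\tau_{\bm m}(t)},\\ &\Psi_3(\bm m,t,z)=(-1)^{m_2}z^{m_1-m_2}e^{\xi(t^{(3)},z^{-1})}\frac{\widetilde\tau_{\bm m+\bm e_1}(t-[z]_3)}{\widetilde\tau_{\bm m}(t)},&& \widetilde\Psi_3(\bm m,t,z)=(-1)^{m_2}z^{-m_1+m_2+1}e^{-\xi(t^{(3)},z^{-1})}\frac{\widetilde\tau_{\bm m-\bm e_1}(t+[z]_3)}{\widetilde\tau_{\bm m}(t)}, \end{align*} as formal series in $z$, infinite in both directions, with coefficients in the fraction field $K$ of $\mathbb C[[t]]$: the factors $\widetilde\tau(t\pm[z^{-1}]_1)$ are expanded in powers of $z^{-1}$, and the factors $\widetilde\tau(t\pm[z]_2)$, $\widetilde\tau(t\pm[z]_3)$ in powers of $z$. Correspondingly, $\oint_{C_R}\frac{dz}{2\pi iz}$ (circle at $z=\infty$) and $\oint_{C_r}\frac{dz}{2\pi iz}$ (circle at $z=0$)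 both mean taking the coefficient of $z^0$. Let $\mathcal B$ be the ring of functions $a(\bm m)=a(\bm m,t)$ from $\mathbb Z^2$ to $K$, let $\Lambda_1,\Lambda_2$ be the shift operators $\Lambda_i(f(\bm m))=f(\bm m+\bm e_i)$, and let $\mathcal E=\mathcal B[\Lambda_1,\Lambda_1^{-1},\Lambda_2,\Lambda_2^{-1}]$ be the ring of finite sums $\sum_{j_1,j_2}a_{j_1,j_2}(\bm m)\Lambda_1^{j_1}\Lambda_2^{j_2}$, which acts on functions of $(\bm m,t,z)$. Let $n_1,n_2,n_3\ge0$ be integers. Then the bilinear equations of the $[n_1,n_2,n_3]$-KdV hierarchy \[ \oint_{C_R}\frac{dz}{2\pi iz}z^{n_1l}\Psi_1(\bm m,t,z)\widetilde\Psi_1(\bm m',t',z) =\oint_{C_r}\frac{dz}{2\pi iz}\Bigl(z^{-n_2l}\Psi_2(\bm m,t,z)\widetilde\Psi_2(\bm m',t',z)+z^{-n_3l}\Psi_3(\bm m,t,z)\widetilde\Psi_3(\bm m',t',z)\Bigr) \] for all integers $l\ge0$, all $\bm m,\bm m'\in\mathbb Z^2$ and independent $t,t'$, hold if and only if both of the following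 hold: \begin{itemize} \item the 3-KP bilinear equation, i.e. the case $l=0$ of the above for all $\bm m,\bm m',t,t'$; \item there exists $\mathfrak L\in\mathcal E$ such that $\mathfrak L(\Psi_1)=z^{n_1}\Psi_1$, $\mathfrak L(\Psi_2)=z^{-n_2}\Psi_2$ and $\mathfrak L(\Psi_3)=z^{-n_3}\Psi_3$. \end{itemize} -/

import Mathlib

noncomputable section

namespace KP3

/-! ### Time variables and functions of the times -/

/-- Index set of the time variables: `(i, k)` stands for the variable `t^{(i+1)}_k`, `k ≥ 1`. -/
abbrev Times := Fin 3 × ℕ+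

/-- Formal functions of `t = (t^{(1)}, t^{(2)}, t^{(3)})`: the power series ring `ℂ⟦t⟧`. -/
abbrev TimeSeries := MvPowerSeries Times ℂ

/-- Formal functions of two independent sets of times `t` (left) and `t'` (right). -/
abbrev TimeSeries₂ := MvPowerSeries (Times ⊕ Times) ℂ

instance (σ : Type) : IsDomain (MvPowerSeries σ ℂ) := NoZeroDivisors.to_isDomain _

/-- The field of quotients of formal power series in the variables `σ`. -/
def SeriesField (σ : Type) : Type := FractionRing (MvPowerSeries σ ℂ)

instance (σ : Type) : Field (SeriesField σ) :=
  inferInstanceAs (Field (FractionRing (MvPowerSeries σ ℂ)))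

instance (σ : Type) : Algebra (MvPowerSeries σ ℂ) (SeriesField σ) :=
  inferInstanceAs (Algebra (MvPowerSeries σ ℂ) (FractionRing (MvPowerSeries σ ℂ)))

instance (σ : Type) : IsFractionRing (MvPowerSeries σ ℂ) (SeriesField σ) :=
  inferInstanceAs (IsFractionRing (MvPowerSeries σ ℂ) (FractionRing (MvPowerSeries σ ℂ)))

/-- Quotients of formal functions of `t`. -/
abbrev TimeField := SeriesField Times

/-- Quotients of formal functions of `t` and `t'`. -/
abbrev TimeField₂ := SeriesField (Times ⊕ Times)

/-- `f ↦ f(t)`. -/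
def atT : TimeSeries →ₐ[ℂ] TimeSeries₂ :=
  MvPowerSeries.rename (Function.Embedding.inl : Times ↪ Times ⊕ Times)

/-- `f ↦ f(t')`. -/
def atT' : TimeSeries →ₐ[ℂ] TimeSeries₂ :=
  MvPowerSeries.rename (Function.Embedding.inr : Times ↪ Times ⊕ Times)

/-! ### Formal series in `z`, infinite in both directions -/

/-- A formal series `∑_{n ∈ ℤ} f n zⁿ` whose coefficients are power series in the variables `σ`. -/
abbrev ZSeries (σ : Type) := ℤ → MvPowerSeries σ ℂ

/-- The sum of a locally finite family of power series: the coefficient of each monomial is the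
sum of the (finitely many nonzero) coefficients of that monomial in the members of the family. -/
def locSum {σ : Type} (f : ℤ → MvPowerSeries σ ℂ) : MvPowerSeries σ ℂ :=
  fun d => ∑ᶠ k : ℤ, MvPowerSeries.coeff d (f k)

theorem coeff_locSum {σ : Type} (f : ℤ → MvPowerSeries σ ℂ) (d : σ →₀ ℕ) :
    MvPowerSeries.coeff d (locSum f) = ∑ᶠ k : ℤ, MvPowerSeries.coeff d (f k) := rfl

/-- The product of two formal series in `z`. -/
def zProd {σ : Type} (f g : ZSeries σ) : ZSeries σ :=
  fun n => locSum fun k => f k * g (n - k)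

/-- The series `z^p f`. -/
def zShift {σ : Type} (p : ℤ) (f : ZSeries σ) : ZSeries σ := fun n => f (n - p)

/-- `p(z)` for a power series `p`. -/
def inZ {σ : Type} (p : PowerSeries (MvPowerSeries σ ℂ)) : ZSeries σ :=
  fun n => if 0 ≤ n then PowerSeries.coeff n.toNat p else 0

/-- `p(z⁻¹)` for a power series `p`. -/
def inZInv {σ : Type} (p : PowerSeries (MvPowerSeries σ ℂ)) : ZSeries σ :=
  fun n => inZ p (-n)

/-- `ξ(t^{(i)}, w) = ∑_{k ≥ 1} t^{(i)}_k w^k`. -/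
def xi (i : Fin 3) : PowerSeries TimeSeries :=
  PowerSeries.mk fun k => if h : 0 < k then MvPowerSeries.X (i, ⟨k, h⟩) else 0

theorem hasSubst_smul_xi (i : Fin 3) (c : ℂ) : PowerSeries.HasSubst (c • xi i) :=
  PowerSeries.HasSubst.of_constantCoeff_zero' (by
    rw [← PowerSeries.coeff_zero_eq_constantCoeff_apply]
    simp [xi])

/-- `exp(c ξ(t^{(i)}, w))`, as a power series in `w`. -/
def expXi (i : Fin 3) (c : ℂ) : PowerSeries TimeSeries :=
  (PowerSeries.exp ℂ).subst (c • xi i)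

/-- The point `t + c [w]_i`, where `[w] = (w, w²/2, w³/3, …)` is added to `t^{(i)}`; the extra
variable `Sum.inr ()` is `w`. -/
def shiftedTimes (i : Fin 3) (c : ℂ) (s : Times) : MvPowerSeries (Times ⊕ Unit) ℂ :=
  MvPowerSeries.X (Sum.inl s) +
    if s.1 = i then (c / (s.2 : ℕ) : ℂ) • MvPowerSeries.X (Sum.inr ()) ^ (s.2 : ℕ) else 0

theorem hasSubst_shiftedTimes (i : Fin 3) (c : ℂ) :
    MvPowerSeries.HasSubst (shiftedTimes i c) where
  const_coeff s := by
    have h : (MvPowerSeries.constantCoeff (shiftedTimes i c s)) = 0 := by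
      unfold shiftedTimes
      split_ifs <;> simp [MvPowerSeries.smul_eq_C_mul]
    rw [h]
    exact IsNilpotent.zero
  coeff_zero d := by
    classical
    refine ((d.support.finite_toSet.preimage Sum.inl_injective.injOn).union
      (Set.finite_singleton (i, Nat.toPNat' (d (Sum.inr ()))))).subset ?_
    intro s hs
    by_contra hns
    rw [Set.mem_union, not_or] at hns
    obtain ⟨h1, h2⟩ := hns
    apply hs
    have e1 : d ≠ Finsupp.single (Sum.inl s) 1 := by
      rintro rfl
      exact h1 (by simp)
    unfold shiftedTimes
    rw [map_add, MvPowerSeries.coeff_X, if_neg e1, zero_add]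
    split_ifs with hi
    · have e2 : d ≠ Finsupp.single (Sum.inr ()) (s.2 : ℕ) := by
        rintro rfl
        exact h2 (by simp [← hi])
      rw [MvPowerSeries.coeff_smul, MvPowerSeries.coeff_X_pow, if_neg e2, mul_zero]
    · simp

/-- The coefficient of `wⁿ` in a power series in `t` and `w`. -/
def wCoeff (n : ℕ) (f : MvPowerSeries (Times ⊕ Unit) ℂ) : TimeSeries :=
  fun d => MvPowerSeries.coeff (Finsupp.sumElim d (Finsupp.single () n)) f

theorem coeff_wCoeff (n : ℕ) (f : MvPowerSeries (Times ⊕ Unit) ℂ) (d : Times →₀ ℕ) :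
    MvPowerSeries.coeff d (wCoeff n f) =
      MvPowerSeries.coeff (Finsupp.sumElim d (Finsupp.single () n)) f := rfl

/-- `f(t + c [w]_i)`, as a power series in `w` with coefficients in `ℂ⟦t⟧`. -/
def shiftSeries (i : Fin 3) (c : ℂ) (f : TimeSeries) : PowerSeries TimeSeries :=
  PowerSeries.mk fun n => wCoeff n (MvPowerSeries.subst (shiftedTimes i c) f)

/-! ### Wave functions -/

/-- A formal series `(∑_{n ∈ ℤ} num n zⁿ) / den` with a common denominator. -/
structure Wave where
  num : ZSeries Times
  den : TimeSeries

/-- The coefficient of `zⁿ`. -/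
def Wave.coeff (f : Wave) (n : ℤ) : TimeField :=
  algebraMap TimeSeries TimeField (f.num n) / algebraMap TimeSeries TimeField f.den

/-- The product `z^p f`. -/
def Wave.zMul (p : ℤ) (f : Wave) : Wave := ⟨zShift p f.num, f.den⟩

/-- `∮ dz/(2πiz) f(t, z) g(t', z)`: the coefficient of `z⁰` in the product. -/
def contour (f g : Wave) : TimeField₂ :=
  algebraMap TimeSeries₂ TimeField₂
      (zProd (fun n => atT (f.num n)) (fun n => atT' (g.num n)) 0) /
    (algebraMap TimeSeries₂ TimeField₂ (atT f.den) *
      algebraMap TimeSeries₂ TimeField₂ (atT' g.den))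

/-- The lattice of the discrete variables `m = (m₁, m₂)`. -/
abbrev Lattice := ℤ × ℤ

section

variable (τ : Lattice → TimeSeries) (m : Lattice)

/-- `Ψ₁ = z^{m₁} e^{ξ(t⁽¹⁾,z)} τ_m(t - [z⁻¹]₁) / τ_m(t)`. -/
def Psi1 : Wave where
  num := zShift m.1 (zProd (inZ (expXi 0 1)) (inZInv (shiftSeries 0 (-1) (τ m))))
  den := τ m

/-- `Ψ̃₁ = z^{-m₁+1} e^{-ξ(t⁽¹⁾,z)} τ_m(t + [z⁻¹]₁) / τ_m(t)`. -/
def adjPsi1 : Wave where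
  num := zShift (-m.1 + 1) (zProd (inZ (expXi 0 (-1))) (inZInv (shiftSeries 0 1 (τ m))))
  den := τ m

/-- `Ψ₂ = z^{m₂} e^{ξ(t⁽²⁾,z⁻¹)} τ_{m+(1,1)}(t - [z]₂) / τ_m(t)`. -/
def Psi2 : Wave where
  num := zShift m.2 (zProd (inZInv (expXi 1 1)) (inZ (shiftSeries 1 (-1) (τ (m + (1, 1))))))
  den := τ m

/-- `Ψ̃₂ = z^{-m₂+1} e^{-ξ(t⁽²⁾,z⁻¹)} τ_{m-(1,1)}(t + [z]₂) / τ_m(t)`. -/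
def adjPsi2 : Wave where
  num := zShift (-m.2 + 1)
    (zProd (inZInv (expXi 1 (-1))) (inZ (shiftSeries 1 1 (τ (m - (1, 1))))))
  den := τ m

/-- `Ψ₃ = (-1)^{m₂} z^{m₁-m₂} e^{ξ(t⁽³⁾,z⁻¹)} τ_{m+(1,0)}(t - [z]₃) / τ_m(t)`. -/
def Psi3 : Wave where
  num := fun n => ((-1 : ℂ) ^ m.2) • zShift (m.1 - m.2)
    (zProd (inZInv (expXi 2 1)) (inZ (shiftSeries 2 (-1) (τ (m + (1, 0)))))) n
  den := τ m

/-- `Ψ̃₃ = (-1)^{m₂} z^{-m₁+m₂+1} e^{-ξ(t⁽³⁾,z⁻¹)} τ_{m-(1,0)}(t + [z]₃) / τ_m(t)`. -/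
def adjPsi3 : Wave where
  num := fun n => ((-1 : ℂ) ^ m.2) • zShift (-m.1 + m.2 + 1)
    (zProd (inZInv (expXi 2 (-1))) (inZ (shiftSeries 2 1 (τ (m - (1, 0)))))) n
  den := τ m

end

/-! ### Bilinear equations -/

/-- The bilinear equations of the `[n₁,n₂,n₃]`-KdV hierarchy, for all `l ≥ 0`. -/
def KdVBilinear (n₁ n₂ n₃ : ℕ) (τ : Lattice → TimeSeries) : Prop :=
  ∀ (l : ℕ) (m m' : Lattice),
    contour ((Psi1 τ m).zMul (n₁ * l)) (adjPsi1 τ m') =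
      contour ((Psi2 τ m).zMul (-(n₂ * l))) (adjPsi2 τ m') +
        contour ((Psi3 τ m).zMul (-(n₃ * l))) (adjPsi3 τ m')

/-- The bilinear equation of the 3-KP hierarchy. -/
def KPBilinear (τ : Lattice → TimeSeries) : Prop :=
  ∀ m m' : Lattice,
    contour (Psi1 τ m) (adjPsi1 τ m') =
      contour (Psi2 τ m) (adjPsi2 τ m') + contour (Psi3 τ m) (adjPsi3 τ m')

/-! ### The ring of difference operators -/

/-- The ring `𝓑` of functions of `m` and `t`. -/
def CoeffRing : Type := Lattice → TimeField

instance : CommRing CoeffRing := inferInstanceAs (CommRing (Lattice → TimeField))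

/-- The lattice acts on `𝓑` by shifts: `(j • a)(m) = a(m + j)`. -/
instance : MulSemiringAction (Multiplicative Lattice) CoeffRing where
  smul j a := fun m => a (m + j.toAdd)
  one_smul a := funext fun m => congrArg a (add_zero m)
  mul_smul i j a := funext fun m => congrArg a (add_assoc m i.toAdd j.toAdd).symm
  smul_zero _ := rfl
  smul_add _ _ _ := rfl
  smul_one _ := rfl
  smul_mul _ _ _ := rfl

/-- The ring `𝓔 = 𝓑[Λ₁, Λ₁⁻¹, Λ₂, Λ₂⁻¹]` of Laurent polynomials `∑ a_{j₁,j₂} Λ₁^{j₁} Λ₂^{j₂}` in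
the shift operators, with `Λ₁^{j₁} Λ₂^{j₂} · a(m) = a(m + j) Λ₁^{j₁} Λ₂^{j₂}`. -/
abbrev DiffOp := SkewMonoidAlgebra CoeffRing (Multiplicative Lattice)

/-- The action of `∑ a_j Λ^j` on functions of `m` and `t` with parameter `z` (given by the
coefficients of the powers of `z`): `f ↦ ∑ a_j(m) f(m + j)`. -/
def DiffOp.act (A : DiffOp) (f : Lattice → ℤ → TimeField) : Lattice → ℤ → TimeField :=
  fun m n => A.coeff.sum fun j a => a m * f (m + j.toAdd) n

end KP3

end

/-! The bilinear relation is linear in `Ψ` over functions of `t`, for coefficients common to the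
three components. If `𝔏` exists, it writes the triple of `z^{n₁}Ψ₁`, `z^{-n₂}Ψ₂`, `z^{-n₃}Ψ₃` at `m`
as a combination, free of `z`, of the triples `Ψ` at shifted points. The equation for `l + 1` thus
follows from the equation for `l` (`orth_of_isEigen`).

Conversely, only `l = 0, 1` are needed. After `z ↦ z⁻¹` in the second and third components, each
wave numerator is an exponential times a series of top degree `delta i m`, with top coefficient `±τ
≠ 0`, and the three degrees sum to zero. Under `Λ₁^{n₁-j} Λ₂^{-n₂}`, `0 ≤ j ≤ N = n₁+n₂+n₃`, they
become `δ₀+n₁-j`, `δ₁+n₂` and `δ₂-n₁-n₂+j ≤ δ₂+n₃`. Triangular elimination (`exists_elimination`)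
with these `N+1` shifts removes the `N+1` top coefficients of the first component of the multiplied
triple. The same combination in all components leaves a triple whose degree bounds sum to `-1` and
which still satisfies the bilinear relation (`exists_relation`).

Such a triple is zero (`eq_zero_of_orth`). On `t' = t` the exponentials cancel (`diag_pair_dress`),
and the relation becomes an identity between three residues. A suitable `m'` kills two of them and
turns the third into the leading coefficient of the triple times a nonzero series. Descent on the
degree then removes every coefficient. -/

noncomputable section

namespace KP3

open MvPowerSeries
open scoped MvPowerSeries.WithPiTopology

/-! ### Locally finite families of power series -/

section LocallyFinite

variable {σ ι : Type}

/-- All coefficients of monomials dividing the monomial `d` vanish. -/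
def VanishesUpTo (d : σ →₀ ℕ) (a : MvPowerSeries σ ℂ) : Prop := ∀ e ≤ d, coeff e a = 0

theorem VanishesUpTo.mul_right {d : σ →₀ ℕ} {a : MvPowerSeries σ ℂ} (h : VanishesUpTo d a)
    (b : MvPowerSeries σ ℂ) : VanishesUpTo d (a * b) := by
  classical
  intro e he
  rw [coeff_mul]
  refine Finset.sum_eq_zero fun x hx => ?_
  rw [h x.1 ((Finset.HasAntidiagonal.mem_antidiagonal.1 hx ▸ le_self_add : x.1 ≤ e).trans he),
    zero_mul]

theorem VanishesUpTo.mul_left {d : σ →₀ ℕ} {a : MvPowerSeries σ ℂ} (h : VanishesUpTo d a)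
    (b : MvPowerSeries σ ℂ) : VanishesUpTo d (b * a) := by
  rw [mul_comm]
  exact h.mul_right b

/-- Every monomial occurs in only finitely many members of the family. -/
def LocFin (f : ι → MvPowerSeries σ ℂ) : Prop := ∀ d, {i | coeff d (f i) ≠ 0}.Finite

theorem LocFin.hasSum {f : ι → MvPowerSeries σ ℂ} (h : LocFin f) :
    HasSum f ((fun d => ∑ᶠ i, coeff d (f i) : MvPowerSeries σ ℂ)) := by
  refine WithPiTopology.hasSum_iff_hasSum_coeff.2 ?_
  intro d
  have e : ∑ᶠ i, coeff d (f i) = ∑ i ∈ (h d).toFinset, coeff d (f i) :=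
    finsum_eq_sum_of_support_subset _ (by intro i hi; simpa using hi)
  change HasSum _ (∑ᶠ i, coeff d (f i))
  rw [e]
  exact hasSum_sum_of_ne_finset_zero (by intro i hi; simpa using hi)

theorem LocFin.hasSum_locSum {f : ℤ → MvPowerSeries σ ℂ} (h : LocFin f) :
    HasSum f (locSum f) := h.hasSum

theorem LocFin.comp_injective {κ : Type} {f : ι → MvPowerSeries σ ℂ} (h : LocFin f) {g : κ → ι}
    (hg : Function.Injective g) : LocFin fun k => f (g k) :=
  fun d => (h d).preimage hg.injOn

theorem locSum_neg (f : ℤ → MvPowerSeries σ ℂ) : locSum (fun k => f (-k)) = locSum f := by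
  ext d
  rw [coeff_locSum, coeff_locSum]
  exact finsum_comp_equiv (Equiv.neg ℤ) (f := fun k => coeff d (f k))

theorem hasSum_rename {τ : Type} (g : σ → τ) [Filter.TendstoCofinite g]
    {f : ι → MvPowerSeries σ ℂ} {a : MvPowerSeries σ ℂ} (h : HasSum f a) :
    HasSum (fun i => rename g (f i)) (rename g a) := by
  rw [WithPiTopology.hasSum_iff_hasSum_coeff] at h ⊢
  intro d
  simp only [coeff_rename]
  exact hasSum_sum fun x _ => h x

/-- The coefficient of each monomial vanishes for all large powers of `z`. -/
def LocBdd (f : ZSeries σ) : Prop := ∀ d, ∃ N : ℤ, ∀ n, N < n → VanishesUpTo d (f n)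

theorem zShift_zero (f : ZSeries σ) : zShift 0 f = f :=
  funext fun n => congrArg f (sub_zero n)

theorem LocBdd.zShift {f : ZSeries σ} (h : LocBdd f) (p : ℤ) : LocBdd (zShift p f) := by
  intro d
  obtain ⟨N, hN⟩ := h d
  exact ⟨N + p, fun n hn => hN _ (by omega)⟩

theorem LocBdd.locFin_mul {f g : ZSeries σ} (hf : LocBdd f) (hg : LocBdd g) (n : ℤ) :
    LocFin fun k => f k * g (n - k) := by
  intro d
  obtain ⟨N, hN⟩ := hf d
  obtain ⟨M, hM⟩ := hg d
  refine (Set.finite_Icc (n - M) N).subset fun k hk => ?_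
  by_contra hcon
  rw [Set.mem_Icc, not_and_or, not_le, not_le] at hcon
  rcases hcon with h | h
  · exact hk ((hM (n - k) (by omega)).mul_left _ d le_rfl)
  · exact hk ((hN k h).mul_right _ d le_rfl)

theorem LocBdd.rename {τ : Type} {f : ZSeries σ} (h : LocBdd f) (e : σ ↪ τ) :
    LocBdd fun n => MvPowerSeries.rename e (f n) := by
  intro d
  -- A monomial dividing `d` can only come from a monomial dividing the pullback of `d`.
  obtain ⟨N, hN⟩ := h (d.comapDomain e e.injective.injOn)
  refine ⟨N, fun n hn x hx => ?_⟩
  rw [coeff_rename]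
  refine Finset.sum_eq_zero fun y hy => hN n hn y fun s => ?_
  have hy' : Finsupp.mapDomain e y = x := by simpa using hy
  rw [Finsupp.comapDomain_apply, ← Finsupp.mapDomain_apply e.injective y s, hy']
  exact hx _

end LocallyFinite

/-! ### The residue pairing and its restriction to `t' = t` -/

section Pairing

/-- `∮ dz/(2πiz) f(t, z) g(t', z)` for series without denominators. -/
def pair (f g : ZSeries Times) : TimeSeries₂ :=
  zProd (fun n => atT (f n)) (fun n => atT' (g n)) 0

theorem hasSum_pair {f g : ZSeries Times} (hf : LocBdd f) (hg : LocBdd g) :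
    HasSum (fun k => atT (f k) * atT' (g (-k))) (pair f g) := by
  have h := (LocBdd.locFin_mul (hf.rename (Function.Embedding.inl : Times ↪ Times ⊕ Times))
    (hg.rename (Function.Embedding.inr : Times ↪ Times ⊕ Times)) 0).hasSum_locSum
  simp only [zero_sub] at h
  unfold pair zProd
  simp only [zero_sub]
  exact h

/-- The coefficients involve `t` only, so they pass through the pairing; `b` serves as a common
denominator. -/
theorem pair_sum {ι : Type} (s : Finset ι) (a : ι → TimeSeries) {f : ι → ZSeries Times}
    {b : TimeSeries} {h g : ZSeries Times}
    (hf : ∀ i ∈ s, LocBdd (f i)) (hh : LocBdd h) (hg : LocBdd g)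
    (e : ∀ n, b * h n = ∑ i ∈ s, a i * f i n) :
    atT b * pair h g = ∑ i ∈ s, atT (a i) * pair (f i) g := by
  refine ((hasSum_pair hh hg).mul_left (atT b)).unique ?_
  have h1 := hasSum_sum fun i (hi : i ∈ s) => (hasSum_pair (hf i hi) hg).mul_left (atT (a i))
  refine h1.congr_fun ?_
  intro k
  rw [← mul_assoc, ← map_mul, e, map_sum, Finset.sum_mul]
  simp [mul_assoc]

/-- Identifying `t'` with `t` is not injective, but its fibres have two elements; this makes the
renaming in `diag` well behaved. -/
instance : Filter.TendstoCofinite (Sum.elim id id : Times ⊕ Times → Times) := by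
  refine (Filter.tendstoCofinite_iff_finite_preimage_singleton _).2 fun t => ?_
  refine (Set.toFinite {Sum.inl t, Sum.inr t}).subset ?_
  rintro (x | x) hx <;> simp_all

/-- `f(t, t') ↦ f(t, t)`. -/
def diag : TimeSeries₂ →ₐ[ℂ] TimeSeries :=
  rename (Sum.elim id id : Times ⊕ Times → Times)

theorem diag_atT (f : TimeSeries) : diag (atT f) = f := by
  unfold diag atT
  rw [rename_rename]
  exact rename_id_apply f

theorem diag_atT' (f : TimeSeries) : diag (atT' f) = f := by
  unfold diag atT'
  rw [rename_rename]
  exact rename_id_apply f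

theorem hasSum_diag_pair {f g : ZSeries Times} (hf : LocBdd f) (hg : LocBdd g) :
    HasSum (fun k => f k * g (-k)) (diag (pair f g)) := by
  have h := hasSum_rename (Sum.elim id id : Times ⊕ Times → Times) (hasSum_pair hf hg)
  refine h.congr_fun fun k => ?_
  change _ = diag (atT (f k) * atT' (g (-k)))
  rw [map_mul, diag_atT, diag_atT']

end Pairing

/-! ### Exponential factors and their cancellation on the diagonal -/

section Dressing

theorem coeff_inZ_of_neg {σ : Type} (p : PowerSeries (MvPowerSeries σ ℂ)) {n : ℤ} (h : n < 0) :
    inZ p n = 0 := if_neg (by omega)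

theorem inZ_natCast {σ : Type} (p : PowerSeries (MvPowerSeries σ ℂ)) (n : ℕ) :
    inZ p n = PowerSeries.coeff n p := by simp [inZ]

/-- Assign weight `k` to `t^{(i)}_k`: the series whose coefficient of `wᵏ` only contains monomials
of weight at least `k`. -/
def weightSubring : Subring (PowerSeries TimeSeries) where
  carrier := {p | ∀ (k : ℕ) (d : Times →₀ ℕ), Finsupp.weight (fun s : Times => (s.2 : ℕ)) d < k →
    coeff d (PowerSeries.coeff k p) = 0}
  zero_mem' := by intro k d _; simp
  one_mem' := by
    intro k d h
    rw [PowerSeries.coeff_one, if_neg (by omega), map_zero]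
  add_mem' := by
    intro p q hp hq k d h
    simp only [map_add, hp k d h, hq k d h, add_zero]
  neg_mem' := by
    intro p hp k d h
    simp only [map_neg, hp k d h, neg_zero]
  mul_mem' := by
    classical
    intro p q hp hq k d h
    rw [PowerSeries.coeff_mul, map_sum]
    refine Finset.sum_eq_zero fun x hx => ?_
    rw [coeff_mul]
    refine Finset.sum_eq_zero fun y hy => ?_
    rw [Finset.HasAntidiagonal.mem_antidiagonal] at hx hy
    rw [← hy, map_add] at h
    rcases lt_or_ge (Finsupp.weight (fun s : Times => (s.2 : ℕ)) y.1) x.1 with h1 | h1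
    · rw [hp _ _ h1, zero_mul]
    · rw [hq x.2 y.2 (by omega), mul_zero]

theorem smul_xi_mem (i : Fin 3) (c : ℂ) : c • xi i ∈ weightSubring := by
  classical
  intro k d h
  rw [PowerSeries.coeff_smul]
  rw [coeff_smul]
  unfold xi
  rw [PowerSeries.coeff_mk]
  split_ifs with hk
  · rw [coeff_X, if_neg, mul_zero]
    rintro rfl
    simp [Finsupp.weight_single] at h
  · simp

/-- Each coefficient is a finite combination of coefficients of powers of `c ξ`, which stay in the
subring. The weight bound is what makes `e^{cξ}` locally bounded. -/
theorem expXi_mem (i : Fin 3) (c : ℂ) : expXi i c ∈ weightSubring := by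
  intro k d h
  unfold expXi
  rw [PowerSeries.coeff_subst' (hasSubst_smul_xi i c)]
  rw [finsum_eq_sum_of_support_subset (s := (PowerSeries.coeff_subst_finite'
    (hasSubst_smul_xi i c) (PowerSeries.exp ℂ) k).toFinset) _ (by simp), map_sum]
  refine Finset.sum_eq_zero fun j _ => ?_
  rw [coeff_smul, pow_mem (smul_xi_mem i c) j k d h, mul_zero]

theorem locBdd_expXi (i : Fin 3) (c : ℂ) : LocBdd (inZ (expXi i c)) := by
  intro d
  refine ⟨Finsupp.weight (fun s : Times => (s.2 : ℕ)) d, fun n hn e he => ?_⟩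
  obtain ⟨k, rfl⟩ := Int.eq_ofNat_of_zero_le (by omega : 0 ≤ n)
  rw [inZ_natCast]
  refine expXi_mem i c k e (lt_of_le_of_lt ?_ (by exact_mod_cast hn :
    Finsupp.weight (fun s : Times => (s.2 : ℕ)) d < k))
  obtain ⟨x, rfl⟩ := exists_add_of_le he
  rw [map_add]
  omega

theorem expXi_mul_neg (i : Fin 3) : expXi i 1 * expXi i (-1) = 1 := by
  have hx := hasSubst_smul_xi i 1
  have h : expXi i (-1) = (PowerSeries.evalNegHom (PowerSeries.exp ℂ)).subst ((1 : ℂ) • xi i) := by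
    rw [PowerSeries.evalNegHom, PowerSeries.rescale_eq_subst,
      PowerSeries.subst_comp_subst_apply (PowerSeries.HasSubst.smul_X' _) hx,
      PowerSeries.subst_smul hx, PowerSeries.subst_X hx, smul_smul, mul_one]
    rfl
  rw [h, expXi, ← PowerSeries.subst_mul hx, PowerSeries.exp_mul_exp_neg_eq_one]
  rw [← PowerSeries.coe_substAlgHom hx, map_one]

theorem hasSum_expXi (i : Fin 3) (s : ℤ) :
    HasSum (fun k => inZ (expXi i 1) k * inZ (expXi i (-1)) (s - k)) (if s = 0 then 1 else 0) := by
  rcases lt_or_ge s 0 with hs | hs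
  · rw [if_neg hs.ne]
    refine hasSum_zero.congr_fun fun k => ?_
    rcases lt_or_ge k 0 with hk | hk
    · rw [coeff_inZ_of_neg _ hk, zero_mul]
    · rw [coeff_inZ_of_neg (expXi i (-1)) (by omega : s - k < 0), mul_zero]
  obtain ⟨n, rfl⟩ := Int.eq_ofNat_of_zero_le hs
  have h := congrArg (PowerSeries.coeff n) (expXi_mul_neg i)
  rw [PowerSeries.coeff_mul, PowerSeries.coeff_one] at h
  simp only [Nat.cast_eq_zero]
  rw [← h, Finset.Nat.sum_antidiagonal_eq_sum_range_succ_mk]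
  have e : ∑ k ∈ Finset.range n.succ, PowerSeries.coeff k (expXi i 1) *
        PowerSeries.coeff (n - k) (expXi i (-1)) =
      ∑ k ∈ (Finset.range n.succ).map Nat.castEmbedding,
        inZ (expXi i 1) k * inZ (expXi i (-1)) (n - k) := by
    rw [Finset.sum_map]
    refine Finset.sum_congr rfl fun k hk => ?_
    have hk' : k ≤ n := by simpa [Nat.lt_succ_iff] using hk
    rw [Nat.castEmbedding_apply, inZ_natCast, ← Nat.cast_sub hk', inZ_natCast]
  rw [e]
  refine hasSum_sum_of_ne_finset_zero fun k hk => ?_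
  rcases lt_or_ge k 0 with h0 | h0
  · rw [coeff_inZ_of_neg _ h0, zero_mul]
  · obtain ⟨j, rfl⟩ := Int.eq_ofNat_of_zero_le h0
    have hj : n < j := by
      by_contra hj
      exact hk (Finset.mem_map.2 ⟨j, by simp; omega, rfl⟩)
    rw [coeff_inZ_of_neg (expXi i (-1)) (by omega : (n : ℤ) - (j : ℤ) < 0), mul_zero]

/-- The product `e^{c ξ(t⁽ⁱ⁾, z)} u`. -/
def dress (i : Fin 3) (c : ℂ) (u : ZSeries Times) : ZSeries Times := zProd (inZ (expXi i c)) u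

theorem locFin_expXi_mul (i : Fin 3) (c : ℂ) (u : ℤ → TimeSeries) :
    LocFin fun k => inZ (expXi i c) k * u k := by
  intro d
  obtain ⟨N, hN⟩ := locBdd_expXi i c d
  refine (Set.finite_Icc 0 N).subset fun k hk => ?_
  by_contra hcon
  rw [Set.mem_Icc, not_and_or, not_le, not_le] at hcon
  rcases hcon with h | h
  · exact hk (by simp [coeff_inZ_of_neg _ h])
  · exact hk ((hN k h).mul_right _ d le_rfl)

theorem hasSum_dress (i : Fin 3) (c : ℂ) (u : ZSeries Times) (n : ℤ) :
    HasSum (fun k => inZ (expXi i c) k * u (n - k)) (dress i c u n) :=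
  (locFin_expXi_mul i c fun k => u (n - k)).hasSum_locSum

theorem zShift_dress (p : ℤ) (i : Fin 3) (c : ℂ) (u : ZSeries Times) :
    zShift p (dress i c u) = dress i c (zShift p u) := by
  funext n
  simp only [zShift, dress, zProd, sub_right_comm]

theorem dress_sum {ι : Type} (s : Finset ι) (i : Fin 3) (c : ℂ) (a : ι → TimeSeries)
    (u : ι → ZSeries Times) (n : ℤ) :
    dress i c (fun p => ∑ j ∈ s, a j * u j p) n = ∑ j ∈ s, a j * dress i c (u j) n := by
  refine (hasSum_dress i c _ n).unique ?_
  refine (hasSum_sum fun j (_ : j ∈ s) => (hasSum_dress i c (u j) n).mul_left (a j)).congr_fun ?_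
  intro k
  rw [Finset.mul_sum]
  exact Finset.sum_congr rfl fun j _ => by ring

theorem dress_smul (i : Fin 3) (c x : ℂ) (u : ZSeries Times) :
    dress i c (x • u) = x • dress i c u := by
  funext n
  refine (hasSum_dress i c _ n).unique ?_
  rw [Pi.smul_apply, smul_eq_C_mul]
  refine ((hasSum_dress i c u n).mul_left (C x)).congr_fun fun k => ?_
  rw [Pi.smul_apply, smul_eq_C_mul]
  ring

theorem locBdd_dress (i : Fin 3) (c : ℂ) {u : ZSeries Times} {B : ℤ} (h : ∀ n, B < n → u n = 0) :
    LocBdd (dress i c u) := by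
  intro d
  obtain ⟨N, hN⟩ := locBdd_expXi i c d
  refine ⟨B + N, fun n hn e he => ?_⟩
  unfold dress zProd
  rw [coeff_locSum]
  refine finsum_eq_zero_of_forall_eq_zero fun k => ?_
  rcases lt_or_ge N k with hk | hk
  · exact (hN k hk).mul_right _ e he
  · rw [h (n - k) (by omega), mul_zero, map_zero]

/-- For a fixed monomial, the bounds on `u`, `v` and on both sides of `f`, `g` confine `(k, a, b)`
to a box. This finiteness licenses the reordering in `diag_pair_dress`. -/
theorem locFin_mul_mul {σ : Type} {f g u v : ZSeries σ} {A B : ℤ} (hf : LocBdd f) (hg : LocBdd g)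
    (hf0 : ∀ n < 0, f n = 0) (hg0 : ∀ n < 0, g n = 0) (hu : ∀ n, A < n → u n = 0)
    (hv : ∀ n, B < n → v n = 0) {F : ℤ × ℤ × ℤ → MvPowerSeries σ ℂ}
    (hF₀ : ∀ k a b, F (k, a, b) = (f a * u (k - a)) * (g b * v (-k - b))) : LocFin F := by
  intro d
  obtain ⟨N, hN⟩ := hf d
  obtain ⟨M, hM⟩ := hg d
  refine ((Set.finite_Icc (-(B + M)) (A + N)).prod
    ((Set.finite_Icc 0 N).prod (Set.finite_Icc 0 M))).subset ?_
  rintro ⟨k, a, b⟩ hx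
  have ha : 0 ≤ a := by
    by_contra h
    exact hx (by simp [hF₀, hf0 _ (not_le.1 h)])
  have hb : 0 ≤ b := by
    by_contra h
    exact hx (by simp [hF₀, hg0 _ (not_le.1 h)])
  have ha' : a ≤ N := by
    by_contra h
    exact hx (by rw [hF₀]; exact ((hN a (not_le.1 h)).mul_right _).mul_right _ d le_rfl)
  have hb' : b ≤ M := by
    by_contra h
    exact hx (by rw [hF₀]; exact ((hM b (not_le.1 h)).mul_right _).mul_left _ d le_rfl)
  have h1 : k - a ≤ A := by
    by_contra h
    exact hx (by simp [hF₀, hu _ (not_le.1 h)])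
  have h2 : -k - b ≤ B := by
    by_contra h
    exact hx (by simp [hF₀, hv _ (not_le.1 h)])
  simp only [Set.mem_prod, Set.mem_Icc]
  omega

/-- On the diagonal `t' = t` the two exponential factors of the pairing cancel. -/
theorem diag_pair_dress (i : Fin 3) {u v : ZSeries Times} {A B : ℤ} (hu : ∀ n, A < n → u n = 0)
    (hv : ∀ n, B < n → v n = 0) :
    HasSum (fun p => u p * v (-p)) (diag (pair (dress i 1 u) (dress i (-1) v))) := by
  obtain ⟨F, hF₀⟩ : ∃ F : ℤ × ℤ × ℤ → TimeSeries, ∀ k a b, F (k, a, b) =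
      (inZ (expXi i 1) a * u (k - a)) * (inZ (expXi i (-1)) b * v (-k - b)) :=
    ⟨fun x => (inZ (expXi i 1) x.2.1 * u (x.1 - x.2.1)) *
      (inZ (expXi i (-1)) x.2.2 * v (-x.1 - x.2.2)), fun _ _ _ => rfl⟩
  have hF : LocFin F := locFin_mul_mul (locBdd_expXi i 1) (locBdd_expXi i (-1))
    (fun _ => coeff_inZ_of_neg _) (fun _ => coeff_inZ_of_neg _) hu hv hF₀
  have h1 : ∀ k, HasSum (fun y : ℤ × ℤ => F (k, y))
      (dress i 1 u k * dress i (-1) v (-k)) := fun k => by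
    have h0 : LocFin fun y : ℤ × ℤ => F (k, y) := hF.comp_injective (Prod.mk_right_injective k)
    have e : (fun y : ℤ × ℤ => F (k, y)) = fun y => (inZ (expXi i 1) y.1 * u (k - y.1)) *
        (inZ (expXi i (-1)) y.2 * v (-k - y.2)) := funext fun y => hF₀ k y.1 y.2
    rw [e] at h0 ⊢
    have hm := (hasSum_dress i 1 u k).mul (hasSum_dress i (-1) v (-k)) h0.hasSum.summable
    exact hm
  have h2 := (hF.hasSum.prod_fiberwise h1).unique
    (hasSum_diag_pair (locBdd_dress i 1 hu) (locBdd_dress i (-1) hv))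
  rw [← h2]
  -- New indices: `p = k - a` is the index of `u`, `s = a + b` the total exponential degree, `c =
  -- a`. Summing over `c` gives the coefficient of `z^s` in `e^ξ e^{-ξ} = 1`, so only `s = 0`
  -- survives.
  let e : (ℤ × ℤ) × ℤ ≃ ℤ × ℤ × ℤ :=
    { toFun := fun x => (x.1.1 + x.2, x.2, x.1.2 - x.2)
      invFun := fun y => ((y.1 - y.2.1, y.2.1 + y.2.2), y.2.1)
      left_inv := fun x => by ext <;> simp
      right_inv := fun y => by ext <;> simp }
  have h3 := (e.hasSum_iff).2 hF.hasSum
  have h4 : ∀ b : ℤ × ℤ, HasSum (fun c => (F ∘ e) (b, c))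
      (u b.1 * v (-b.1 - b.2) * if b.2 = 0 then 1 else 0) := fun b => by
    refine ((hasSum_expXi i b.2).mul_left (u b.1 * v (-b.1 - b.2))).congr_fun fun c => ?_
    simp only [hF₀, e, Function.comp_apply, Equiv.coe_fn_mk, add_sub_cancel_right]
    rw [show -(b.1 + c) - (b.2 - c) = -b.1 - b.2 by ring]
    ring
  refine (h3.prod_fiberwise h4).prod_fiberwise fun p => ?_
  have h5 := hasSum_ite_eq (0 : ℤ) (u p * v (-p))
  refine h5.congr_fun fun s => ?_
  split_ifs with hs
  · obtain rfl : s = 0 := hs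
    simp
  · simp

end Dressing

/-! ### The leading term of a shifted tau function -/

section Shift

theorem wCoeff_zero (f : MvPowerSeries (Times ⊕ Unit) ℂ) :
    wCoeff 0 f = killCompl (Function.Embedding.inl : Times ↪ Times ⊕ Unit) f := by
  ext d
  rw [coeff_wCoeff, coeff_killCompl]
  congr 1
  refine congrArg (fun x => coeff x) (Finsupp.ext fun x => ?_)
  rcases x with s | s
  · exact (Finsupp.embDomain_apply_self (Function.Embedding.inl : Times ↪ Times ⊕ Unit) d s).symm
  · rw [Finsupp.embDomain_of_notMem_range _ _ _ (by simp), Finsupp.sumElim_apply]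
    simp

theorem killCompl_shiftedTimes (i : Fin 3) (c : ℂ) (s : Times) :
    killCompl (Function.Embedding.inl : Times ↪ Times ⊕ Unit) (shiftedTimes i c s) = X s := by
  have h1 : killCompl (R := ℂ) (Function.Embedding.inl : Times ↪ Times ⊕ Unit)
      (X (Sum.inl s)) = X s := killCompl_X s
  have h2 : killCompl (R := ℂ) (Function.Embedding.inl : Times ↪ Times ⊕ Unit)
      (X (Sum.inr ())) = 0 := killCompl_X_eq_zero (by simp)
  unfold shiftedTimes
  split_ifs <;> simp [h1, h2]

/-- Setting `w = 0` is the algebra map `killCompl`, which sends each shifted time back to its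
variable. This identifies the top coefficients of the waves with `±τ`. -/
theorem coeff_zero_shiftSeries (i : Fin 3) (c : ℂ) (f : TimeSeries) :
    PowerSeries.coeff 0 (shiftSeries i c f) = f := by
  unfold shiftSeries
  rw [PowerSeries.coeff_mk, wCoeff_zero]
  classical
  ext d
  rw [coeff_killCompl, coeff_subst (hasSubst_shiftedTimes i c)]
  have h : ∀ x : Times →₀ ℕ, coeff (Finsupp.embDomain Function.Embedding.inl d)
      (x.prod fun s n => shiftedTimes i c s ^ n) = coeff d (monomial x (1 : ℂ)) := fun x => by
    rw [← coeff_killCompl, map_finsuppProd, monomial_one_eq]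
    simp only [map_pow, killCompl_shiftedTimes]
  simp only [h, coeff_monomial]
  rw [finsum_eq_single _ d]
  · simp
  · intro x hx
    rw [if_neg (Ne.symm hx), smul_zero]

theorem inZInv_shiftSeries_zero (i : Fin 3) (c : ℂ) (f : TimeSeries) :
    inZInv (shiftSeries i c f) 0 = f := by
  rw [← coeff_zero_shiftSeries i c f]
  simp [inZInv, inZ, coeff_zero_shiftSeries]

theorem inZInv_of_pos {σ : Type} (p : PowerSeries (MvPowerSeries σ ℂ)) {n : ℤ} (h : 0 < n) :
    inZInv p n = 0 := coeff_inZ_of_neg p (by omega)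

end Shift

/-! ### Wave functions in a uniform variable -/

section UniformWaves

/-- The order of growth of the `i`-th wave function at `m`, in the variable `z` for `i = 0` and
`z⁻¹` for `i = 1, 2`. -/
def delta (i : Fin 3) (m : Lattice) : ℤ := ![m.1, -m.2, m.2 - m.1] i

/-- The shift of the tau function in the `i`-th wave function. -/
def tauShift : Fin 3 → Lattice := ![0, (1, 1), (1, 0)]

/-- The sign in the `i`-th wave function. -/
def waveSign (i : Fin 3) (m : Lattice) : ℂ := ![1, 1, (-1) ^ m.2] i

theorem waveSign_ne_zero (i : Fin 3) (m : Lattice) : waveSign i m ≠ 0 := by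
  fin_cases i <;> simp [waveSign, zpow_ne_zero]

variable (τ : Lattice → TimeSeries)

/-- The numerator of the `i`-th wave function without its exponential factor, in the variable `z`
for `i = 0` and `z⁻¹` for `i = 1, 2`. -/
def wave (i : Fin 3) (m : Lattice) : ZSeries Times :=
  waveSign i m • zShift (delta i m) (inZInv (shiftSeries i (-1) (τ (m + tauShift i))))

/-- The numerator of the `i`-th adjoint wave function without its exponential factor, in the
variable `z` for `i = 0` and `z⁻¹` for `i = 1, 2`. -/
def adjWave (i : Fin 3) (m : Lattice) : ZSeries Times :=
  waveSign i m • zShift (-delta i m + ![1, -1, -1] i)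
    (inZInv (shiftSeries i 1 (τ (m - tauShift i))))

/-- The numerator of the `i`-th wave function. -/
def dressedWave (i : Fin 3) (m : Lattice) : ZSeries Times := dress i 1 (wave τ i m)

/-- The numerator of the `i`-th adjoint wave function. -/
def dressedAdjWave (i : Fin 3) (m : Lattice) : ZSeries Times := dress i (-1) (adjWave τ i m)

variable {τ}

theorem wave_of_lt {i : Fin 3} {m : Lattice} {n : ℤ} (h : delta i m < n) : wave τ i m n = 0 := by
  rw [wave, Pi.smul_apply, zShift, inZInv_of_pos _ (by omega), smul_zero]

theorem wave_delta_ne_zero (hτ : ∀ m, τ m ≠ 0) (i : Fin 3) (m : Lattice) :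
    wave τ i m (delta i m) ≠ 0 := by
  rw [wave, Pi.smul_apply, zShift, sub_self, inZInv_shiftSeries_zero]
  exact smul_ne_zero (waveSign_ne_zero i m) (hτ _)

theorem adjWave_of_lt {i : Fin 3} {m : Lattice} {n : ℤ} (h : -delta i m + ![1, -1, -1] i < n) :
    adjWave τ i m n = 0 := by
  rw [adjWave, Pi.smul_apply, zShift, inZInv_of_pos _ (by omega), smul_zero]

theorem adjWave_top_ne_zero (hτ : ∀ m, τ m ≠ 0) (i : Fin 3) (m : Lattice) :
    adjWave τ i m (-delta i m + ![1, -1, -1] i) ≠ 0 := by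
  rw [adjWave, Pi.smul_apply, zShift, sub_self, inZInv_shiftSeries_zero]
  exact smul_ne_zero (waveSign_ne_zero i m) (hτ _)

theorem locBdd_dressedWave (i : Fin 3) (m : Lattice) : LocBdd (dressedWave τ i m) :=
  locBdd_dress i 1 fun _ => wave_of_lt

theorem locBdd_dressedAdjWave (i : Fin 3) (m : Lattice) : LocBdd (dressedAdjWave τ i m) :=
  locBdd_dress i (-1) fun _ => adjWave_of_lt

theorem zProd_inZInv_inZ {σ : Type} (p q : PowerSeries (MvPowerSeries σ ℂ)) (n : ℤ) :
    zProd (inZInv p) (inZ q) n = zProd (inZ p) (inZInv q) (-n) := by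
  unfold zProd
  rw [← locSum_neg]
  congr 1
  funext k
  simp only [inZInv]
  congr 2 <;> ring

theorem dress_smul_zShift_apply (i : Fin 3) (c x : ℂ) (p n : ℤ) (u : ZSeries Times) :
    dress i c (x • zShift p u) n = x • zProd (inZ (expXi i c)) u (n - p) := by
  rw [dress_smul, ← zShift_dress]
  rfl

theorem Psi1_num (m : Lattice) (n : ℤ) : (Psi1 τ m).num n = dressedWave τ 0 m n := by
  rw [dressedWave, wave, dress_smul_zShift_apply]
  simp [Psi1, zShift, waveSign, delta, tauShift]

theorem Psi2_num (m : Lattice) (n : ℤ) : (Psi2 τ m).num n = dressedWave τ 1 m (-n) := by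
  rw [dressedWave, wave, dress_smul_zShift_apply]
  simp only [Psi2, zShift, zProd_inZInv_inZ]
  simp [waveSign, delta, tauShift, sub_eq_add_neg, add_comm]

theorem Psi3_num (m : Lattice) (n : ℤ) : (Psi3 τ m).num n = dressedWave τ 2 m (-n) := by
  rw [dressedWave, wave, dress_smul_zShift_apply]
  simp only [Psi3, zShift, zProd_inZInv_inZ]
  simp only [waveSign, delta, tauShift]
  simp [show -(n - (m.1 - m.2)) = -n - (m.2 - m.1) by ring]

theorem adjPsi1_num (m : Lattice) (n : ℤ) : (adjPsi1 τ m).num n = dressedAdjWave τ 0 m n := by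
  rw [dressedAdjWave, adjWave, dress_smul_zShift_apply]
  simp [adjPsi1, zShift, waveSign, delta, tauShift]

theorem adjPsi2_num (m : Lattice) (n : ℤ) : (adjPsi2 τ m).num n = dressedAdjWave τ 1 m (-n) := by
  rw [dressedAdjWave, adjWave, dress_smul_zShift_apply]
  simp only [adjPsi2, zShift, zProd_inZInv_inZ]
  simp only [waveSign, delta, tauShift]
  simp [show -(n - (-m.2 + 1)) = -n - (m.2 + -1) by ring]

theorem adjPsi3_num (m : Lattice) (n : ℤ) : (adjPsi3 τ m).num n = dressedAdjWave τ 2 m (-n) := by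
  rw [dressedAdjWave, adjWave, dress_smul_zShift_apply]
  simp only [adjPsi3, zShift, zProd_inZInv_inZ]
  simp only [waveSign, delta, tauShift]
  simp [show -(n - (-m.1 + m.2 + 1)) = -n - (m.1 - m.2 + -1) by ring]

end UniformWaves

/-! ### Bilinear equations as relations between numerators -/

section Contour

theorem contour_eq_pair {f g : Wave} {u v : ZSeries Times} {d d' : TimeSeries}
    (hd : f.den = d) (hd' : g.den = d') (hf : ∀ n, f.num n = u n)
    (hg : ∀ n, g.num n = v n) :
    contour f g = algebraMap TimeSeries₂ TimeField₂ (pair u v) /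
      (algebraMap TimeSeries₂ TimeField₂ (atT d) *
        algebraMap TimeSeries₂ TimeField₂ (atT' d')) := by
  simp only [contour, pair, hf, hg, hd, hd']

/-- The coefficient of `z⁰` is invariant under `z ↦ z⁻¹`. -/
theorem contour_eq_pair_of_neg {f g : Wave} {u v : ZSeries Times} {d d' : TimeSeries}
    (hd : f.den = d) (hd' : g.den = d') (hf : ∀ n, f.num n = u (-n))
    (hg : ∀ n, g.num n = v (-n)) :
    contour f g = algebraMap TimeSeries₂ TimeField₂ (pair u v) /
      (algebraMap TimeSeries₂ TimeField₂ (atT d) *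
        algebraMap TimeSeries₂ TimeField₂ (atT' d')) := by
  have h : zProd (fun n => atT (f.num n)) (fun n => atT' (g.num n)) 0 = pair u v := by
    unfold pair zProd
    rw [← locSum_neg]
    simp only [hf, hg]
    congr 1
    funext k
    congr 3 <;> ring_nf
  rw [contour, h, hd, hd']

/-- The bilinear relation between two triples of series. -/
def Orth (f g : Fin 3 → ZSeries Times) : Prop :=
  pair (f 0) (g 0) = pair (f 1) (g 1) + pair (f 2) (g 2)

theorem atT_injective : Function.Injective atT :=
  rename_injective (Function.Embedding.inl : Times ↪ Times ⊕ Times)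

theorem atT'_injective : Function.Injective atT' :=
  rename_injective (Function.Embedding.inr : Times ↪ Times ⊕ Times)

/-- The three contour integrals share the denominator `τ_m(t) τ_{m'}(t')`, which is nonzero and
cancels. -/
theorem algebraMap_div_eq_iff {d d' : TimeSeries} (hd : d ≠ 0) (hd' : d' ≠ 0)
    (x y z : TimeSeries₂) :
    algebraMap TimeSeries₂ TimeField₂ x /
        (algebraMap TimeSeries₂ TimeField₂ (atT d) * algebraMap TimeSeries₂ TimeField₂ (atT' d')) =
      algebraMap TimeSeries₂ TimeField₂ y /
        (algebraMap TimeSeries₂ TimeField₂ (atT d) * algebraMap TimeSeries₂ TimeField₂ (atT' d')) +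
      algebraMap TimeSeries₂ TimeField₂ z /
        (algebraMap TimeSeries₂ TimeField₂ (atT d) * algebraMap TimeSeries₂ TimeField₂ (atT' d')) ↔
    x = y + z := by
  have hi := IsFractionRing.injective TimeSeries₂ TimeField₂
  have h1 : algebraMap TimeSeries₂ TimeField₂ (atT d) ≠ 0 :=
    (map_ne_zero_iff _ hi).2 ((map_ne_zero_iff _ atT_injective).2 hd)
  have h2 : algebraMap TimeSeries₂ TimeField₂ (atT' d') ≠ 0 :=
    (map_ne_zero_iff _ hi).2 ((map_ne_zero_iff _ atT'_injective).2 hd')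
  rw [← add_div, div_left_inj' (mul_ne_zero h1 h2), ← map_add, hi.eq_iff]

variable {τ : Lattice → TimeSeries}

theorem contour_eq_iff_orth (hτ : ∀ m, τ m ≠ 0) (n : Fin 3 → ℤ) (m m' : Lattice) :
    contour ((Psi1 τ m).zMul (n 0)) (adjPsi1 τ m') =
        contour ((Psi2 τ m).zMul (-n 1)) (adjPsi2 τ m') +
          contour ((Psi3 τ m).zMul (-n 2)) (adjPsi3 τ m') ↔
      Orth (fun i => zShift (n i) (dressedWave τ i m)) (fun i => dressedAdjWave τ i m') := by
  have h0 : ∀ p, ((Psi1 τ m).zMul (n 0)).num p = zShift (n 0) (dressedWave τ 0 m) p :=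
    fun p => by simp only [Wave.zMul, zShift, Psi1_num]
  have h1 : ∀ p, ((Psi2 τ m).zMul (-n 1)).num p = zShift (n 1) (dressedWave τ 1 m) (-p) :=
    fun p => by simp only [Wave.zMul, zShift, Psi2_num, sub_neg_eq_add, neg_add']
  have h2 : ∀ p, ((Psi3 τ m).zMul (-n 2)).num p = zShift (n 2) (dressedWave τ 2 m) (-p) :=
    fun p => by simp only [Wave.zMul, zShift, Psi3_num, sub_neg_eq_add, neg_add']
  rw [contour_eq_pair (d := τ m) (d' := τ m') rfl rfl h0 (adjPsi1_num m'),
    contour_eq_pair_of_neg (d := τ m) (d' := τ m') rfl rfl h1 (adjPsi2_num m'),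
    contour_eq_pair_of_neg (d := τ m) (d' := τ m') rfl rfl h2 (adjPsi3_num m')]
  rw [algebraMap_div_eq_iff (hτ m) (hτ m')]
  rfl

theorem kdvBilinear_iff (hτ : ∀ m, τ m ≠ 0) (n : Fin 3 → ℕ) :
    KdVBilinear (n 0) (n 1) (n 2) τ ↔ ∀ (l : ℕ) (m m' : Lattice),
      Orth (fun i => zShift (n i * l) (dressedWave τ i m)) (fun i => dressedAdjWave τ i m') :=
  forall_congr' fun l => forall₂_congr fun m m' =>
    contour_eq_iff_orth hτ (fun i => (n i * l : ℤ)) m m'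

theorem Wave.zMul_zero (f : Wave) : f.zMul 0 = f := by
  rw [Wave.zMul, zShift_zero]

theorem kpBilinear_iff (hτ : ∀ m, τ m ≠ 0) :
    KPBilinear τ ↔ ∀ m m' : Lattice,
      Orth (fun i => dressedWave τ i m) (fun i => dressedAdjWave τ i m') := by
  refine forall₂_congr fun m m' => ?_
  have h := contour_eq_iff_orth hτ (fun _ => 0) m m'
  simp only [neg_zero, Wave.zMul_zero] at h
  rw [h]
  simp only [zShift_zero]

end Contour

/-! ### Eigenvalue equations in the uniform variable -/

section Operators

variable {τ : Lattice → TimeSeries}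

/-- The eigenvalue equation for the `i`-th wave function. -/
def IsEigen (τ : Lattice → TimeSeries) (L : DiffOp) (i : Fin 3) (n : ℤ) : Prop :=
  ∀ (m : Lattice) (p : ℤ),
    (L.coeff.sum fun j a => a m *
      (algebraMap TimeSeries TimeField (dressedWave τ i (m + j.toAdd) p) /
      algebraMap TimeSeries TimeField (τ (m + j.toAdd)))) =
    algebraMap TimeSeries TimeField (dressedWave τ i m (p - n)) /
      algebraMap TimeSeries TimeField (τ m)

theorem act_Psi1_iff (L : DiffOp) (n : ℤ) :
    (DiffOp.act L fun m => (Psi1 τ m).coeff) = (fun m => ((Psi1 τ m).zMul n).coeff) ↔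
      IsEigen τ L 0 n := by
  rw [funext_iff]
  refine forall_congr' fun m => funext_iff.trans (forall_congr' fun p => ?_)
  simp only [DiffOp.act, Wave.coeff, Wave.zMul, zShift, Psi1_num]
  rfl

theorem act_Psi2_iff (L : DiffOp) (n : ℤ) :
    (DiffOp.act L fun m => (Psi2 τ m).coeff) = (fun m => ((Psi2 τ m).zMul (-n)).coeff) ↔
      IsEigen τ L 1 n := by
  rw [funext_iff]
  refine forall_congr' fun m => funext_iff.trans ((Equiv.neg ℤ).forall_congr fun {p} => ?_)
  simp only [DiffOp.act, Wave.coeff, Wave.zMul, zShift, Psi2_num, Equiv.neg_apply,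
    sub_neg_eq_add, neg_add, ← sub_eq_add_neg]
  rfl

theorem act_Psi3_iff (L : DiffOp) (n : ℤ) :
    (DiffOp.act L fun m => (Psi3 τ m).coeff) = (fun m => ((Psi3 τ m).zMul (-n)).coeff) ↔
      IsEigen τ L 2 n := by
  rw [funext_iff]
  refine forall_congr' fun m => funext_iff.trans ((Equiv.neg ℤ).forall_congr fun {p} => ?_)
  simp only [DiffOp.act, Wave.coeff, Wave.zMul, zShift, Psi3_num, Equiv.neg_apply,
    sub_neg_eq_add, neg_add, ← sub_eq_add_neg]
  rfl

end Operators

/-! ### Rigidity of the bilinear relation -/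

section Vanishing

theorem residue_eq_zero {u v : ZSeries Times} {r : TimeSeries} {A B : ℤ}
    (h : HasSum (fun p => u p * v (-p)) r) (hu : ∀ n, A < n → u n = 0)
    (hv : ∀ n, B < n → v n = 0) (hAB : A + B < 0) : r = 0 := by
  refine h.unique (hasSum_zero.congr_fun fun p => ?_)
  rcases lt_or_ge A p with hp | hp
  · rw [hu p hp, zero_mul]
  · rw [hv (-p) (by omega), mul_zero]

/-- Only the product of the two top coefficients contributes: at any other index one factor lies
above its degree bound. -/
theorem residue_eq_mul {u v : ZSeries Times} {r : TimeSeries} {A B : ℤ}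
    (h : HasSum (fun p => u p * v (-p)) r) (hu : ∀ n, A < n → u n = 0)
    (hv : ∀ n, B < n → v n = 0) (hAB : A + B = 0) : r = u A * v B := by
  obtain rfl : B = -A := by omega
  refine h.unique (hasSum_single A fun p hp => ?_)
  rcases lt_or_gt_of_ne hp with hp | hp
  · rw [hv (-p) (by omega), mul_zero]
  · rw [hu p hp, zero_mul]

theorem eq_zero_of_descent {u : ZSeries Times} {A : ℤ} (hu : ∀ n, A < n → u n = 0)
    (step : ∀ B ≤ A, (∀ n, B < n → u n = 0) → u B = 0) : ∀ n, u n = 0 := by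
  have key : ∀ (k : ℕ) (n : ℤ), A - k < n → u n = 0 := by
    intro k
    induction k with
    | zero => simpa using hu
    | succ k ih =>
      intro n hn
      rcases lt_or_ge (A - k) n with h | h
      · exact ih n h
      · obtain rfl : n = A - k := by push_cast at hn; omega
        exact step _ (by omega) ih
  intro n
  exact key (A - n + 1).toNat n (by omega)

variable {τ : Lattice → TimeSeries}

/-- A triple of series that satisfies the bilinear relation with all adjoint wave functions, and
whose orders of growth add up to less than zero, vanishes. -/
theorem eq_zero_of_orth (hτ : ∀ m, τ m ≠ 0) {u : Fin 3 → ZSeries Times} {a : Fin 3 → ℤ}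
    (ha : a 0 + a 1 + a 2 < 0) (hu : ∀ i n, a i < n → u i n = 0)
    (h : ∀ m', Orth (fun i => dress i 1 (u i)) (fun i => dressedAdjWave τ i m')) :
    ∀ i n, u i n = 0 := by
  let r (i : Fin 3) (m : Lattice) : TimeSeries :=
    diag (pair (dress i 1 (u i)) (dressedAdjWave τ i m))
  have hr : ∀ i m, HasSum (fun p => u i p * adjWave τ i m (-p)) (r i m) := fun i m =>
    diag_pair_dress i (hu i) fun _ => adjWave_of_lt
  have hsum : ∀ m, r 0 m = r 1 m + r 2 m := fun m => by
    have := congrArg diag (h m)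
    rwa [map_add] at this
  have hzero : ∀ i m B, (∀ n, B < n → u i n = 0) → B + (-delta i m + ![1, -1, -1] i) < 0 →
      r i m = 0 := fun i m B hB hlt => residue_eq_zero (hr i m) hB (fun _ => adjWave_of_lt) hlt
  have hlead : ∀ i m B, (∀ n, B < n → u i n = 0) → B + (-delta i m + ![1, -1, -1] i) = 0 →
      r i m = 0 → u i B = 0 := fun i m B hB heq h0 => by
    rw [residue_eq_mul (hr i m) hB (fun _ => adjWave_of_lt) heq] at h0
    exact (mul_eq_zero.1 h0).resolve_right (adjWave_top_ne_zero hτ i m)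
  have u0 : ∀ n, u 0 n = 0 := by
    refine eq_zero_of_descent (hu 0) fun B hBA hB => ?_
    -- `m₁ = B + 1` puts residue 0 at its leading term, and `m₂ = -a 1` gives residue 1 degree bound
    -- `-1`. Residue 2 then has degree bound `B + a 1 + a 2`, negative because `B ≤ a 0`.
    have h1 := hzero 1 (B + 1, -a 1) (a 1) (hu 1) (by simp [delta])
    have h2 := hzero 2 (B + 1, -a 1) (a 2) (hu 2) (by simp [delta]; omega)
    refine hlead 0 (B + 1, -a 1) B hB (by simp [delta]) ?_
    rw [hsum, h1, h2, add_zero]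
  have r0 : ∀ m, r 0 m = 0 := fun m =>
    hzero 0 m (delta 0 m - 2) (fun n _ => u0 n) (by simp; omega)
  have u1 : ∀ n, u 1 n = 0 := by
    refine eq_zero_of_descent (hu 1) fun B hBA hB => ?_
    -- `m₂ = 1 - B` isolates the leading term of residue 1; the free `m₁` is chosen to give residue
    -- 2 degree bound `-1`.
    have h2 := hzero 2 (1 - B - a 2, 1 - B) (a 2) (hu 2) (by simp [delta])
    refine hlead 1 (1 - B - a 2, 1 - B) B hB (by simp [delta]; omega) ?_
    have := hsum (1 - B - a 2, 1 - B)
    rw [r0, h2, add_zero] at this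
    exact this.symm
  have u2 : ∀ n, u 2 n = 0 := by
    refine eq_zero_of_descent (hu 2) fun B hBA hB => ?_
    have h1 := hzero 1 (1 - B, 0) (delta 1 (1 - B, 0)) (fun n _ => u1 n) (by simp)
    refine hlead 2 (1 - B, 0) B hB (by simp [delta]; omega) ?_
    have := hsum (1 - B, 0)
    rw [r0, h1, zero_add] at this
    exact this.symm
  intro i
  fin_cases i
  exacts [u0, u1, u2]

end Vanishing

/-! ### Triangular elimination of leading coefficients -/

section Elimination

/-- Triangular elimination: the leading coefficients of `u` can be removed one after the other by
series `w j` with leading terms in the degrees `B - j`. -/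
theorem exists_elimination {u : ZSeries Times} {w : ℕ → ZSeries Times} {B : ℤ}
    (hu : ∀ n, B < n → u n = 0) (hw : ∀ (j : ℕ) n, B - j < n → w j n = 0)
    (hw0 : ∀ j : ℕ, w j (B - j) ≠ 0) (k : ℕ) :
    ∃ (A : TimeSeries) (c : ℕ → TimeSeries), A ≠ 0 ∧
      ∀ n, B - k < n → A * u n = ∑ j ∈ Finset.range k, c j * w j n := by
  induction k with
  | zero => exact ⟨1, 0, one_ne_zero, fun n hn => by simp [hu n (by simpa using hn)]⟩
  | succ k ih =>
    obtain ⟨A, c, hA, h⟩ := ih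
    let e : TimeSeries := A * u (B - k) - ∑ j ∈ Finset.range k, c j * w j (B - k)
    -- To avoid division, the old relation is multiplied by the leading coefficient of `w k`; `e` is
    -- its defect in degree `B - k`.
    refine ⟨A * w k (B - k), fun j => if j = k then e else c j * w k (B - k),
      mul_ne_zero hA (hw0 k), fun n hn => ?_⟩
    rw [Finset.sum_range_succ]
    simp only [if_true]
    have hs : ∑ j ∈ Finset.range k, (if j = k then e else c j * w k (B - k)) * w j n =
        w k (B - k) * ∑ j ∈ Finset.range k, c j * w j n := by
      rw [Finset.mul_sum]
      refine Finset.sum_congr rfl fun j hj => ?_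
      rw [if_neg (Finset.mem_range.1 hj).ne]
      ring
    rw [hs]
    rcases lt_or_ge (B - k) n with hlt | hge
    · rw [← h n hlt, hw k n hlt]
      ring
    · obtain rfl : n = B - k := by push_cast at hn; omega
      ring

end Elimination

/-! ### From bilinear equations to the operator and back -/

section Main

variable {τ : Lattice → TimeSeries}

theorem Orth.of_sum {ι : Type} (s : Finset ι) (a : ι → TimeSeries) {f : ι → Fin 3 → ZSeries Times}
    {b : TimeSeries} {h g : Fin 3 → ZSeries Times} (hb : b ≠ 0)
    (hf : ∀ j ∈ s, ∀ i, LocBdd (f j i)) (hh : ∀ i, LocBdd (h i)) (hg : ∀ i, LocBdd (g i))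
    (e : ∀ i n, b * h i n = ∑ j ∈ s, a j * f j i n) (ho : ∀ j ∈ s, Orth (f j) g) : Orth h g := by
  have hb' : atT b ≠ 0 := (map_ne_zero_iff _ atT_injective).2 hb
  refine mul_left_cancel₀ hb' ?_
  rw [mul_add, pair_sum s a (fun j hj => hf j hj 0) (hh 0) (hg 0) (e 0),
    pair_sum s a (fun j hj => hf j hj 1) (hh 1) (hg 1) (e 1),
    pair_sum s a (fun j hj => hf j hj 2) (hh 2) (hg 2) (e 2), ← Finset.sum_add_distrib]
  refine Finset.sum_congr rfl fun j hj => ?_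
  rw [← mul_add]
  exact congrArg _ (ho j hj)

/-- The shifts of the difference operator. -/
def opShift (n : Fin 3 → ℕ) (j : ℕ) : Lattice := ((n 0 : ℤ) - j, -(n 1 : ℤ))

theorem opShift_injective (n : Fin 3 → ℕ) : Function.Injective (opShift n) := by
  intro j k h
  have := congrArg Prod.fst h
  simp only [opShift] at this
  omega

theorem exists_relation (hτ : ∀ m, τ m ≠ 0) (n : Fin 3 → ℕ)
    (h0 : ∀ m m' : Lattice, Orth (fun i => dressedWave τ i m) (fun i => dressedAdjWave τ i m'))
    (m : Lattice)
    (h1 : ∀ m' : Lattice, Orth (fun i => zShift (n i) (dressedWave τ i m))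
      (fun i => dressedAdjWave τ i m')) :
    ∃ (A : TimeSeries) (c : ℕ → TimeSeries), A ≠ 0 ∧ ∀ i p,
      A * dressedWave τ i m (p - n i) =
        ∑ j ∈ Finset.range (n 0 + n 1 + n 2 + 1), c j * dressedWave τ i (m + opShift n j) p := by
  obtain ⟨A, c, hA, hc⟩ := exists_elimination (u := zShift (n 0) (wave τ 0 m))
    (w := fun j => wave τ 0 (m + opShift n j)) (B := delta 0 m + n 0)
    (fun p hp => wave_of_lt (by omega))
    (fun j p hp => wave_of_lt (by simp [delta, opShift] at hp ⊢; omega))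
    (fun j => by
      have := wave_delta_ne_zero hτ 0 (m + opShift n j)
      rwa [show delta 0 (m + opShift n j) = delta 0 m + n 0 - j by
        simp [delta, opShift, add_sub_assoc]] at this)
    (n 0 + n 1 + n 2 + 1)
  refine ⟨A, c, hA, ?_⟩
  let S : Finset (Option ℕ) := Finset.insertNone (Finset.range (n 0 + n 1 + n 2 + 1))
  let a : Option ℕ → TimeSeries := fun o => o.elim A fun j => -c j
  let f : Option ℕ → Fin 3 → ZSeries Times := fun o i =>
    o.elim (zShift (n i) (wave τ i m)) fun j => wave τ i (m + opShift n j)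
  let U : Fin 3 → ZSeries Times := fun i p => ∑ o ∈ S, a o * f o i p
  have hU : ∀ i p, U i p = A * wave τ i m (p - n i) -
      ∑ j ∈ Finset.range (n 0 + n 1 + n 2 + 1), c j * wave τ i (m + opShift n j) p := by
    intro i p
    simp only [U, S, Finset.sum_insertNone]
    simp [a, f, zShift, sub_eq_add_neg]
  -- As the `delta i m` sum to zero, these bounds sum to `-1`, just below the threshold of
  -- `eq_zero_of_orth`.
  have hbd : ∀ i p, (delta i m + n i - if i = 0 then n 0 + n 1 + n 2 + 1 else 0 : ℤ) < p →
      U i p = 0 := by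
    intro i p hp
    rw [hU]
    fin_cases i
    · rw [sub_eq_zero]
      refine hc p ?_
      simpa using hp
    · rw [wave_of_lt (by simp at hp ⊢; omega), mul_zero, Finset.sum_eq_zero, sub_zero]
      intro j hj
      rw [wave_of_lt, mul_zero]
      simp [delta, opShift] at hp ⊢
      omega
    · rw [wave_of_lt (by simp at hp ⊢; omega), mul_zero, Finset.sum_eq_zero, sub_zero]
      intro j hj
      rw [wave_of_lt, mul_zero]
      -- The shift by `opShift n j` changes `delta 2` by `j - n 0 - n 1`, at most `n 2` precisely
      -- because `j ≤ n 0 + n 1 + n 2`.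
      rw [Finset.mem_range] at hj
      simp [delta, opShift] at hp ⊢
      omega
  have hdf : ∀ o i, LocBdd (dress i 1 (f o i)) := by
    intro o i
    rcases o with _ | j
    · change LocBdd (dress i 1 (zShift (n i) (wave τ i m)))
      rw [← zShift_dress]
      exact (locBdd_dressedWave i m).zShift _
    · exact locBdd_dressedWave i _
  have horth : ∀ m', Orth (fun i => dress i 1 (U i)) (fun i => dressedAdjWave τ i m') := by
    intro m'
    refine Orth.of_sum S a (f := fun o i => dress i 1 (f o i)) one_ne_zero (fun o _ i => hdf o i)
      (fun i => locBdd_dress i 1 (hbd i)) (fun i => locBdd_dressedAdjWave i m')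
      (fun i p => ?_) (fun o _ => ?_)
    · rw [one_mul]
      exact dress_sum S i 1 a (fun o => f o i) p
    · rcases o with _ | j
      · have := h1 m'
        simp only [dressedWave, zShift_dress] at this
        exact this
      · exact h0 _ m'
  have hz := eq_zero_of_orth hτ
    (a := fun i => (delta i m + n i - if i = 0 then n 0 + n 1 + n 2 + 1 else 0 : ℤ))
    (by simp [delta]; omega) hbd horth
  intro i p
  have hd : dress i 1 (U i) p = 0 := by
    have : U i = 0 := funext (hz i)
    rw [this]
    exact (hasSum_dress i 1 0 p).unique (hasSum_zero.congr_fun fun k => by simp)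
  have hd' := dress_sum S i 1 a (fun o => f o i) p
  change dress i 1 (U i) p = _ at hd'
  rw [hd] at hd'
  simp only [S, Finset.sum_insertNone] at hd'
  have e : dress i 1 (f none i) p = dressedWave τ i m (p - n i) := by
    change dress i 1 (zShift (n i) (wave τ i m)) p = _
    rw [← zShift_dress]
    rfl
  rw [e] at hd'
  simp only [a, Option.elim, neg_mul, Finset.sum_neg_distrib] at hd'
  exact eq_of_sub_eq_zero ((sub_eq_add_neg _ _).trans hd'.symm)

theorem exists_isEigen (hτ : ∀ m, τ m ≠ 0) (n : Fin 3 → ℕ)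
    (h0 : ∀ m m' : Lattice, Orth (fun i => dressedWave τ i m) (fun i => dressedAdjWave τ i m'))
    (h1 : ∀ m m' : Lattice, Orth (fun i => zShift (n i) (dressedWave τ i m))
      (fun i => dressedAdjWave τ i m')) :
    ∃ L : DiffOp, ∀ i, IsEigen τ L i (n i) := by
  choose A c hA hc using fun m => exists_relation hτ n h0 m (h1 m)
  let K := algebraMap TimeSeries TimeField
  have hi : Function.Injective K := IsFractionRing.injective TimeSeries TimeField
  have hK : ∀ x : TimeSeries, x ≠ 0 → K x ≠ 0 := fun x hx => (map_ne_zero_iff _ hi).2 hx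
  -- The ratio of tau functions passes from numerators to wave functions, whose denominators are `τ
  -- (m + opShift n j)` and `τ m`.
  let a : ℕ → CoeffRing := fun j m => K (c m j) * K (τ (m + opShift n j)) / (K (A m) * K (τ m))
  let e : ℕ ↪ Multiplicative Lattice :=
    ⟨fun j => Multiplicative.ofAdd (opShift n j), fun j k h =>
      opShift_injective n (Multiplicative.ofAdd.injective h)⟩
  refine ⟨⟨∑ j ∈ Finset.range (n 0 + n 1 + n 2 + 1), Finsupp.single (e j) (a j)⟩, fun i m p => ?_⟩
  change Finsupp.sum (∑ j ∈ Finset.range (n 0 + n 1 + n 2 + 1), Finsupp.single (e j) (a j)) _ = _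
  rw [← Finsupp.sum_finsetSum_index (fun _ => zero_mul _) (fun _ _ _ => add_mul _ _ _)]
  have hrel := congrArg K (hc m i p)
  rw [map_mul, map_sum] at hrel
  rw [eq_div_iff (hK _ (hτ m)), ← mul_right_inj' (hK _ (hA m)), hrel, Finset.sum_mul,
    Finset.mul_sum]
  refine Finset.sum_congr rfl fun j _ => ?_
  rw [Finsupp.sum_single_index (zero_mul _), map_mul]
  change K (A m) * (K (c m j) * K (τ (m + opShift n j)) / (K (A m) * K (τ m)) *
    (K (dressedWave τ i (m + opShift n j) p) / K (τ (m + opShift n j))) * K (τ m)) = _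
  have h2 := hK _ (hA m)
  have h3 := hK _ (hτ m)
  have h4 := hK _ (hτ (m + opShift n j))
  field_simp

theorem exists_relation_of_isEigen (hτ : ∀ m, τ m ≠ 0) (n : Fin 3 → ℕ) {L : DiffOp}
    (hL : ∀ i, IsEigen τ L i (n i)) (m : Lattice) :
    ∃ (A : TimeSeries) (c : Multiplicative Lattice → TimeSeries), A ≠ 0 ∧ ∀ i p,
      A * dressedWave τ i m (p - n i) =
        ∑ j ∈ L.coeff.support, c j * dressedWave τ i (m + j.toAdd) p := by
  let K := algebraMap TimeSeries TimeField
  have hi : Function.Injective K := IsFractionRing.injective TimeSeries TimeField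
  have hK : ∀ x : TimeSeries, x ≠ 0 → K x ≠ 0 := fun x hx => (map_ne_zero_iff _ hi).2 hx
  -- At a fixed `m` the operator has finitely many coefficients, hence a common denominator `A`.
  obtain ⟨A, hA⟩ := IsLocalization.exist_integer_multiples (nonZeroDivisors TimeSeries)
    L.coeff.support
    (fun j => (L.coeff j : Lattice → TimeField) m * K (τ m) / K (τ (m + j.toAdd)))
  choose! c hc using hA
  refine ⟨A, c, nonZeroDivisors.coe_ne_zero A, fun i p => hi ?_⟩
  rw [map_sum, map_mul]
  have h := hL i m p
  rw [eq_div_iff (hK _ (hτ m)), Finsupp.sum, Finset.sum_mul] at h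
  change K A * K (dressedWave τ i m (p - n i)) = _
  rw [← h, Finset.mul_sum]
  refine Finset.sum_congr rfl fun j hj => ?_
  have hcj : K (c j) = K A * ((L.coeff j : Lattice → TimeField) m * K (τ m) /
      K (τ (m + j.toAdd))) := (hc j hj).trans (Algebra.smul_def _ _)
  rw [map_mul]
  change _ = K (c j) * _
  rw [hcj]
  change K A * ((L.coeff j : Lattice → TimeField) m * (K _ / K _) * K _) = _
  ring

theorem orth_of_isEigen (hτ : ∀ m, τ m ≠ 0) (n : Fin 3 → ℕ)
    (h0 : ∀ m m' : Lattice, Orth (fun i => dressedWave τ i m) (fun i => dressedAdjWave τ i m'))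
    {L : DiffOp} (hL : ∀ i, IsEigen τ L i (n i)) (l : ℕ) :
    ∀ m m' : Lattice, Orth (fun i => zShift (n i * l) (dressedWave τ i m))
      (fun i => dressedAdjWave τ i m') := by
  induction l with
  | zero =>
    simpa [zShift_zero] using h0
  | succ l ih =>
    intro m m'
    obtain ⟨A, c, hA, hc⟩ := exists_relation_of_isEigen hτ n hL m
    refine Orth.of_sum L.coeff.support c
      (f := fun j i => zShift (n i * l) (dressedWave τ i (m + j.toAdd))) hA
      (fun j _ i => (locBdd_dressedWave i _).zShift _) (fun i => (locBdd_dressedWave i _).zShift _)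
      (fun i => locBdd_dressedAdjWave i m') (fun i p => ?_) (fun j _ => ih _ m')
    simp only [zShift]
    rw [← hc i (p - n i * l)]
    congr 2
    push_cast
    ring

end Main

end KP3

end

theorem mainTheorem3 (n₁ n₂ n₃ : ℕ) (τ : KP3.Lattice → KP3.TimeSeries) (hτ : ∀ m, τ m ≠ 0) :
    KP3.KdVBilinear n₁ n₂ n₃ τ ↔
      KP3.KPBilinear τ ∧
        ∃ L : KP3.DiffOp,
          (KP3.DiffOp.act L fun m => (KP3.Psi1 τ m).coeff) =
              (fun m => ((KP3.Psi1 τ m).zMul n₁).coeff) ∧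
            (KP3.DiffOp.act L fun m => (KP3.Psi2 τ m).coeff) =
              (fun m => ((KP3.Psi2 τ m).zMul (-n₂)).coeff) ∧
            (KP3.DiffOp.act L fun m => (KP3.Psi3 τ m).coeff) =
              (fun m => ((KP3.Psi3 τ m).zMul (-n₃)).coeff) := by
  have hk := KP3.kdvBilinear_iff hτ ![n₁, n₂, n₃]
  simp only [KP3.act_Psi1_iff, KP3.act_Psi2_iff, KP3.act_Psi3_iff]
  rw [KP3.kpBilinear_iff hτ]
  refine hk.trans ⟨fun h => ?_, fun ⟨h0, L, hL0, hL1, hL2⟩ => ?_⟩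
  -- The cases `l = 0` and `l = 1` already produce the operator.
  · have h0 := h 0
    have h1 := h 1
    simp only [Nat.cast_zero, mul_zero, KP3.zShift_zero] at h0
    simp only [Nat.cast_one, mul_one] at h1
    obtain ⟨L, hL⟩ := KP3.exists_isEigen hτ _ h0 h1
    exact ⟨h0, L, hL 0, hL 1, hL 2⟩
  · refine KP3.orth_of_isEigen hτ _ h0 (L := L) fun i => ?_
    fin_cases i
    exacts [hL0, hL1, hL2]
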